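/- Let $I=[0,1]$ and, for $\beta\in(0,1)$, let $F_{\beta,\beta}:I\times I\to I\times I$ be the skew product $$F_{\beta,\beta}(x,y)=\begin{cases}\bigl(2x,\;y+y(1-y)(y-\beta)\bigr), & 0\le x\le 1/2,\\ \bigl(2x-1,\;y-y(1-y)(y-\beta)\bigr), & 1/2<x\le 1.\end{cases}$$ Let $m$ be Lebesgue measure on $I\times I$. The basin $\mathcal B(A)$ of a set $A$ is the set of points $p$ whose $\omega$-limit set (the set of limit points of $F^n(p)$ as $n\to\infty$) is contained in $A$. A compact set $A$ with $F(A)=A$ is a Milnor attractor if $m(\mathcal B(A))>0$ and there is no compact proper subset $A'$ of $A$ whose basin coincides with $\mathcal B(A)$ up to a set of measure zero. For two distinct Milnor attractors $A,A'$, the basin of $A$ is riddled with the basin of $A'$ if $m(B_\varepsilon(p)\cap\mathcal B(A'))>0$ for all $p\in A$ and $\varepsilon>0$; the basins of $A$ and $A'$ are intermingled if they are riddled with each other. Suppose $(\beta,\beta)\in\Gamma_S$, where $$\Gamma_S=\Bigl\{(\beta_1,\beta_2): \beta_1,\beta_2\in(0,1),\ 2-\tfrac1{\beta_1}<\beta_2<\tfrac1{1-\beta_1}-1\Bigr\}.$$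 Then the three distinct sets $A_0=I\times\{0\}$, $A_1=I\times\{1\}$ and $A_\beta=I\times\{\beta\}$ are Milnor attractors of $F_{\beta,\beta}$, and for each $i\in\{0,1\}$ the basins of $A_i$ and $A_\beta$ are intermingled. Moreover, the intermingling is global in the strips between the attractors: the strips $S_0=I\times[0,\beta]$ and $S_1=I\times[\beta,1]$ are mapped into themselves by $F_{\beta,\beta}$ and, for $i\in\{0,1\}$, every nonempty relatively open subset of $S_i$ meets both $\mathcal B(A_i)$ and $\mathcal B(A_\beta)$ in a set of positive Lebesgue measure. -/

import Mathlib

open Set MeasureTheory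
open scoped unitInterval

section Attractors

variable {M : Type*}

/-- The basin of attraction of `A`: the points whose `ω`-limit set is contained in `A`. The
`ω`-limit set of `p` is the set of limit points of the sequence `F^[n] p`, `n → ∞`. -/
def basin [TopologicalSpace M] (F : M → M) (A : Set M) : Set M :=
  {p | omegaLimit Filter.atTop (fun n : ℕ => F^[n]) {p} ⊆ A}

/-- `A` is a Milnor attractor of `F`: it is compact and invariant, its basin has non-zero volume,
and no compact proper subset of `A` has the same basin up to a null set. -/
structure IsMilnorAttractor [TopologicalSpace M] [MeasureSpace M] (F : M → M) (A : Set M) :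
    Prop where
  isCompact : IsCompact A
  image_eq : F '' A = A
  basin_pos : 0 < volume (basin F A)
  minimal : ∀ A' : Set M, A' ⊂ A → IsCompact A' → ¬ (basin F A' =ᵐ[volume] basin F A)

/-- The basin of the Milnor attractor `A` is riddled with the basin of another Milnor attractor
`A'`: every ball centred at a point of `A` meets the basin of `A'` in positive volume. -/
structure RiddledWith [PseudoMetricSpace M] [MeasureSpace M] (F : M → M) (A A' : Set M) :
    Prop where
  left : IsMilnorAttractor F A
  right : IsMilnorAttractor F A'
  ne : A ≠ A'
  ball_pos : ∀ p ∈ A, ∀ ε : ℝ, 0 < ε → 0 < volume (Metric.ball p ε ∩ basin F A')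

/-- The basins of `A` and `A'` are intermingled: they are riddled with each other. -/
def Intermingled [PseudoMetricSpace M] [MeasureSpace M] (F : M → M) (A A' : Set M) : Prop :=
  RiddledWith F A A' ∧ RiddledWith F A' A

/-- The basins of `A` and `A'` are globally intermingled inside the region `S`: `S` is mapped
into itself, and every nonempty relatively open subset of `S` meets both basins in positive
volume. -/
def IntermingledWithin [TopologicalSpace M] [MeasureSpace M] (F : M → M) (S A A' : Set M) :
    Prop :=
  MapsTo F S S ∧
    ∀ U : Set M, IsOpen U → (U ∩ S).Nonempty →
      0 < volume (U ∩ S ∩ basin F A) ∧ 0 < volume (U ∩ S ∩ basin F A')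

end Attractors

noncomputable section PlanarFamily

/-- The base map `f`: `x ↦ 2 x` for `x ≤ 1/2` and `x ↦ 2 x - 1` for `x > 1/2`. -/
def baseMap (x : I) : I :=
  ⟨if (x : ℝ) ≤ 1 / 2 then 2 * (x : ℝ) else 2 * (x : ℝ) - 1, by
    have h0 := x.2.1
    have h1 := x.2.2
    split_ifs with h
    · exact ⟨by linarith, by linarith⟩
    · exact ⟨by linarith, by linarith⟩⟩

/-- The fibre map `g₁(y) = y + y (1 - y) (y - β)`, used over `x ≤ 1/2`. -/
def fiberMap₁ (β : Ioo (0 : ℝ) 1) (y : I) : I :=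
  ⟨(y : ℝ) + (y : ℝ) * (1 - (y : ℝ)) * ((y : ℝ) - (β : ℝ)), by
    have h0 := y.2.1
    have h1 := y.2.2
    have b0 := β.2.1
    have b1 := β.2.2
    have hy : 0 ≤ (y : ℝ) * (1 - y) := mul_nonneg h0 (by linarith)
    constructor
    · nlinarith [mul_nonneg hy h0, mul_nonneg hy (sub_nonneg.2 b1.le), mul_nonneg h0 h0]
    · nlinarith [mul_nonneg hy (sub_nonneg.2 h1), mul_nonneg hy b0.le,
        mul_nonneg (sub_nonneg.2 h1) (sub_nonneg.2 h1)]⟩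

/-- The fibre map `g₂(y) = y - y (1 - y) (y - β)`, used over `x > 1/2`. -/
def fiberMap₂ (β : Ioo (0 : ℝ) 1) (y : I) : I :=
  ⟨(y : ℝ) - (y : ℝ) * (1 - (y : ℝ)) * ((y : ℝ) - (β : ℝ)), by
    have h0 := y.2.1
    have h1 := y.2.2
    have b0 := β.2.1
    have b1 := β.2.2
    have hy : 0 ≤ (y : ℝ) * (1 - y) := mul_nonneg h0 (by linarith)
    constructor
    · nlinarith [mul_nonneg hy (sub_nonneg.2 h1), mul_nonneg hy b0.le, mul_nonneg h0 h0]
    · nlinarith [mul_nonneg hy h0, mul_nonneg hy (sub_nonneg.2 b1.le),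
        mul_nonneg (sub_nonneg.2 h1) (sub_nonneg.2 h1)]⟩

/-- The planar skew product `F_{β₁,β₂}` of the unit square. -/
def planarMap (β₁ β₂ : Ioo (0 : ℝ) 1) (p : I × I) : I × I :=
  (baseMap p.1, if (p.1 : ℝ) ≤ 1 / 2 then fiberMap₁ β₁ p.2 else fiberMap₂ β₂ p.2)

/-- The parameter region `Γ_S`. -/
def GammaS : Set (ℝ × ℝ) :=
  {b | b.1 ∈ Ioo (0 : ℝ) 1 ∧ b.2 ∈ Ioo (0 : ℝ) 1 ∧
    2 - 1 / b.1 < b.2 ∧ b.2 < 1 / (1 - b.1) - 1}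

/-- The horizontal segment `[0,1] × {c}`. -/
def hLine (c : I) : Set (I × I) := {p | p.2 = c}

/-- A parameter in `(0,1)` seen as a height in `[0,1]`. -/
def toHeight (β : Ioo (0 : ℝ) 1) : I := ⟨(β : ℝ), Ioo_subset_Icc_self β.2⟩

end PlanarFamily

open Filter Topology

/-! For Lebesgue-random `x` the binary digits are fair coin flips, and the two fibre maps are `y +
d(y)` and `y - d(y)` with the same `d`. So the height is a bounded martingale (`integral_height`).
Its second moment bounds the total expected squared displacement (`integral_compensated`), hence
displacements tend to zero almost surely; in a strip, where `d` vanishes only at the edges, the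
height must then converge to an edge (`IsStrip.ae_tendsto`). From an interior height each edge has
positive probability, since otherwise conservation of the mean would put the starting height on the
other edge (`IsStrip.volume_tendsto_pos`).

Self-similarity localises this: `n` steps expand a dyadic cell of order `n` onto the whole base and
carry a horizontal slice over it to a single height (`exists_le_volume_dyadicCell`). Interior slices
of a small box thus meet both basins in positive length, and Fubini gives positive area
(`IsStrip.volume_basin_pos`).

Minimality comes from the base: almost every doubling orbit is dense, so for almost every point an
omega-limit set contained in a horizontal line is the whole line (`volume_basin_eq_zero`). -/

/-! ### Inverse branches of the doubling map and Lebesgue measure. -/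

/-- The left inverse branch `x ↦ x / 2` of the doubling map. -/
noncomputable def leftBranch (x : I) : I :=
  ⟨(x : ℝ) / 2, by have := x.2.1; have := x.2.2; constructor <;> linarith⟩

/-- The right inverse branch `x ↦ (x + 1) / 2` of the doubling map. -/
noncomputable def rightBranch (x : I) : I :=
  ⟨((x : ℝ) + 1) / 2, by have := x.2.1; have := x.2.2; constructor <;> linarith⟩

theorem measurable_leftBranch : Measurable leftBranch :=
  (measurable_subtype_coe.div_const 2).subtype_mk

theorem measurable_rightBranch : Measurable rightBranch :=
  ((measurable_subtype_coe.add_const 1).div_const 2).subtype_mk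

/-- Lebesgue measure on `I` is self-similar under the two branches; `A` need not be measurable. -/
theorem volume_eq_branches (A : Set I) :
    volume A = 2⁻¹ * volume (leftBranch ⁻¹' A) + 2⁻¹ * volume (rightBranch ⁻¹' A) := by
  set C : Set ℝ := (↑) '' A with hC
  have hl : ((↑) '' (leftBranch ⁻¹' A) : Set ℝ) = (fun t => 2⁻¹ * t) ⁻¹' (C ∩ Iic (1 / 2)) := by
    ext t
    constructor
    · rintro ⟨x, hx, rfl⟩
      exact ⟨⟨_, hx, by simp [leftBranch]; ring⟩, by have := x.2.2; simp; linarith⟩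
    · rintro ⟨⟨x, hx, hxt⟩, h2⟩
      have h0 := x.2.1
      simp only [mem_Iic] at h2
      refine ⟨⟨t, by linarith, by linarith⟩, ?_, rfl⟩
      rw [mem_preimage]
      convert hx
      ext; simp [leftBranch, hxt]; ring
  have hr : ((↑) '' (rightBranch ⁻¹' A) : Set ℝ) =
      (fun t => t + 1) ⁻¹' ((fun t => 2⁻¹ * t) ⁻¹' (C ∩ Ici (1 / 2))) := by
    ext t
    constructor
    · rintro ⟨x, hx, rfl⟩
      exact ⟨⟨_, hx, by simp [rightBranch]; ring⟩, by have := x.2.1; simp; linarith⟩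
    · rintro ⟨⟨x, hx, hxt⟩, h2⟩
      have h0 := x.2.2
      simp only [mem_Ici] at h2
      refine ⟨⟨t, by linarith, by linarith⟩, ?_, rfl⟩
      rw [mem_preimage]
      convert hx
      ext; simp [rightBranch, hxt]; ring
  have hd : volume (C ∩ Ici (1 / 2)) = volume (C \ Iic (1 / 2)) := by
    rw [sdiff_eq, compl_Iic]
    exact measure_congr ((ae_eq_refl C).inter Ioi_ae_eq_Ici.symm)
  rw [unitInterval.volume_apply, unitInterval.volume_apply (s := leftBranch ⁻¹' A),
    unitInterval.volume_apply (s := rightBranch ⁻¹' A), hl, hr, measure_preimage_add_right,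
    Real.volume_preimage_mul_left (by norm_num), Real.volume_preimage_mul_left (by norm_num), hd]
  have h2 : ENNReal.ofReal |(2⁻¹ : ℝ)⁻¹| = 2 := by norm_num
  rw [h2, ← mul_assoc, ← mul_assoc, ENNReal.inv_mul_cancel (by norm_num) (by norm_num),
    one_mul, one_mul, measure_inter_add_sdiff _ measurableSet_Iic]

theorem volume_eq_map_branches :
    (volume : Measure I) = (2⁻¹ : ENNReal) • volume.map leftBranch +
      (2⁻¹ : ENNReal) • volume.map rightBranch := by
  ext A hA
  simp only [Measure.coe_add, Measure.coe_smul, Pi.add_apply, Pi.smul_apply, smul_eq_mul,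
    Measure.map_apply measurable_leftBranch hA, Measure.map_apply measurable_rightBranch hA]
  exact volume_eq_branches A

/-- Conditioning on the first binary digit; this drives the inductions for the martingale
identities. -/
theorem integral_eq_branches {φ : I → ℝ} (hφ : Measurable φ) {c : ℝ} (hc : ∀ x, |φ x| ≤ c) :
    ∫ x, φ x = (∫ x, φ (leftBranch x)) / 2 + (∫ x, φ (rightBranch x)) / 2 := by
  have hint : ∀ μ : Measure I, IsFiniteMeasure μ → Integrable φ μ := fun μ _ =>
    Integrable.of_bound hφ.aestronglyMeasurable c (.of_forall hc)
  conv_lhs => rw [volume_eq_map_branches]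
  have := Measure.isFiniteMeasure_map (volume : Measure I) leftBranch
  have := Measure.isFiniteMeasure_map (volume : Measure I) rightBranch
  rw [integral_add_measure ((hint _ inferInstance).smul_measure (by norm_num))
    ((hint _ inferInstance).smul_measure (by norm_num)), integral_smul_measure,
    integral_smul_measure, integral_map measurable_leftBranch.aemeasurable
    hφ.aestronglyMeasurable, integral_map measurable_rightBranch.aemeasurable
    hφ.aestronglyMeasurable]
  simp
  ring

theorem baseMap_leftBranch (x : I) : baseMap (leftBranch x) = x := by
  have h : (x : ℝ) / 2 ≤ 1 / 2 := by have := x.2.2; linarith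
  ext
  change (if (x : ℝ) / 2 ≤ 1 / 2 then 2 * ((x : ℝ) / 2) else 2 * ((x : ℝ) / 2) - 1) = x
  rw [if_pos h]
  ring

/-- The point `1/2 = rightBranch 0` belongs to the left piece of `baseMap`, so `x = 0` is excluded
here and later discarded as a null set. -/
theorem rightBranch_gt {x : I} (hx : 0 < (x : ℝ)) : ¬ (rightBranch x : ℝ) ≤ 1 / 2 := by
  simp only [rightBranch]
  linarith

theorem baseMap_rightBranch {x : I} (hx : 0 < (x : ℝ)) : baseMap (rightBranch x) = x := by
  ext
  simp only [baseMap, if_neg (rightBranch_gt hx)]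
  simp only [rightBranch]
  ring

theorem planarMap_leftBranch (β : Ioo (0 : ℝ) 1) (x y : I) :
    planarMap β β (leftBranch x, y) = (x, fiberMap₁ β y) := by
  have h : (leftBranch x : ℝ) ≤ 1 / 2 := by have := x.2.2; simp only [leftBranch]; linarith
  simp only [planarMap, if_pos h, baseMap_leftBranch]

theorem planarMap_rightBranch (β : Ioo (0 : ℝ) 1) {x : I} (hx : 0 < (x : ℝ)) (y : I) :
    planarMap β β (rightBranch x, y) = (x, fiberMap₂ β y) := by
  simp only [planarMap, if_neg (rightBranch_gt hx), baseMap_rightBranch hx]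

theorem ae_coe_pos : ∀ᵐ x : I, 0 < (x : ℝ) := by
  have : ∀ᵐ x : I, x ≠ 0 := by simp [ae_iff]
  filter_upwards [this] with x hx
  exact lt_of_le_of_ne x.2.1 fun h => hx (Subtype.ext h.symm)

theorem measurable_baseMap : Measurable baseMap :=
  (Measurable.ite (measurable_subtype_coe measurableSet_Iic)
    (measurable_subtype_coe.const_mul 2)
    ((measurable_subtype_coe.const_mul 2).sub_const 1)).subtype_mk

theorem continuous_fiberMap₁ (β : Ioo (0 : ℝ) 1) : Continuous (fiberMap₁ β) := by
  unfold fiberMap₁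
  fun_prop

theorem continuous_fiberMap₂ (β : Ioo (0 : ℝ) 1) : Continuous (fiberMap₂ β) := by
  unfold fiberMap₂
  fun_prop

theorem measurable_planarMap (β : Ioo (0 : ℝ) 1) : Measurable (planarMap β β) := by
  refine (measurable_baseMap.comp measurable_fst).prodMk (Measurable.ite ?_
    ((continuous_fiberMap₁ β).measurable.comp measurable_snd)
    ((continuous_fiberMap₂ β).measurable.comp measurable_snd))
  exact (measurable_subtype_coe.comp measurable_fst) measurableSet_Iic

theorem measurePreserving_baseMap : MeasurePreserving baseMap (volume : Measure I) volume := by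
  refine ⟨measurable_baseMap, ?_⟩
  ext A hA
  have hl : leftBranch ⁻¹' (baseMap ⁻¹' A) = A := by
    ext x; simp [baseMap_leftBranch]
  have hr : rightBranch ⁻¹' (baseMap ⁻¹' A) =ᵐ[volume] A := by
    filter_upwards [ae_coe_pos] with x hx
    exact congrArg A (baseMap_rightBranch hx)
  rw [Measure.map_apply measurable_baseMap hA, volume_eq_branches, hl, measure_congr hr,
    ← add_mul, ENNReal.inv_two_add_inv_two, one_mul]

/-! ### The height martingale and its quadratic variation. -/

/-- The vertical coordinate after `n` steps. -/
noncomputable def height (β : Ioo (0 : ℝ) 1) (n : ℕ) (p : I × I) : ℝ :=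
  (((planarMap β β)^[n] p).2 : ℝ)

/-- The vertical displacement. -/
def displacement (β y : ℝ) : ℝ := y * (1 - y) * (y - β)

theorem fiberMap₁_coe (β : Ioo (0 : ℝ) 1) (y : I) :
    (fiberMap₁ β y : ℝ) = y + displacement β y := rfl

theorem fiberMap₂_coe (β : Ioo (0 : ℝ) 1) (y : I) :
    (fiberMap₂ β y : ℝ) = y - displacement β y := rfl

theorem measurable_height (β : Ioo (0 : ℝ) 1) (n : ℕ) : Measurable (height β n) :=
  measurable_subtype_coe.comp (measurable_snd.comp ((measurable_planarMap β).iterate n))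

theorem measurable_height_slice (β : Ioo (0 : ℝ) 1) (n : ℕ) (y : I) :
    Measurable fun x => height β n (x, y) :=
  (measurable_height β n).comp measurable_prodMk_right

theorem height_mem (β : Ioo (0 : ℝ) 1) (n : ℕ) (p : I × I) : height β n p ∈ Icc (0 : ℝ) 1 :=
  ((planarMap β β)^[n] p).2.2

theorem height_zero (β : Ioo (0 : ℝ) 1) (p : I × I) : height β 0 p = p.2 := rfl

theorem height_succ (β : Ioo (0 : ℝ) 1) (n : ℕ) (p : I × I) :
    height β (n + 1) p = height β n (planarMap β β p) := rfl

/-- The height process is a martingale: its mean is constant. -/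
theorem integral_height (β : Ioo (0 : ℝ) 1) (n : ℕ) (y : I) :
    ∫ x : I, height β n (x, y) = y := by
  induction n generalizing y with
  | zero => simp [height_zero]
  | succ n ih =>
    rw [integral_eq_branches (measurable_height_slice β (n + 1) y) (c := 1)
      fun x => abs_le.2 ⟨by linarith [(height_mem β (n + 1) (x, y)).1], (height_mem β _ _).2⟩]
    have hr : (fun x => height β (n + 1) (rightBranch x, y)) =ᵐ[volume]
        fun x => height β n (x, fiberMap₂ β y) := by
      filter_upwards [ae_coe_pos] with x hx
      rw [height_succ, planarMap_rightBranch β hx]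
    rw [integral_congr_ae hr]
    simp_rw [height_succ, planarMap_leftBranch, ih, fiberMap₁_coe, fiberMap₂_coe]
    ring

theorem measurable_displacement (β : ℝ) : Measurable (displacement β) := by
  unfold displacement
  fun_prop

theorem sq_displacement_le (β : Ioo (0 : ℝ) 1) {y : ℝ} (hy : y ∈ Icc (0 : ℝ) 1) :
    displacement β y ^ 2 ≤ 1 := by
  have h := hy.1
  have h' := hy.2
  have b0 := β.2.1
  have b1 := β.2.2
  rw [displacement, mul_pow]
  exact mul_le_one₀ (pow_le_one₀ (mul_nonneg h (by linarith)) (by nlinarith)) (sq_nonneg _)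
    (by nlinarith)

/-- The sum of the squared displacements, compensated by the square of the height. -/
noncomputable def compensated (β : Ioo (0 : ℝ) 1) (n : ℕ) (p : I × I) : ℝ :=
  ∑ k ∈ Finset.range n, displacement β (height β k p) ^ 2 - height β n p ^ 2

theorem compensated_succ (β : Ioo (0 : ℝ) 1) (n : ℕ) (p : I × I) :
    compensated β (n + 1) p = displacement β p.2 ^ 2 + compensated β n (planarMap β β p) := by
  simp only [compensated, Finset.sum_range_succ', height_succ, height_zero]
  ring

theorem measurable_compensated (β : Ioo (0 : ℝ) 1) (n : ℕ) : Measurable (compensated β n) :=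
  (Finset.measurable_sum _ fun k _ =>
    ((measurable_displacement β).comp (measurable_height β k)).pow_const 2).sub
      ((measurable_height β n).pow_const 2)

theorem measurable_compensated_slice (β : Ioo (0 : ℝ) 1) (n : ℕ) (y : I) :
    Measurable fun x => compensated β n (x, y) :=
  (measurable_compensated β n).comp measurable_prodMk_right

theorem abs_compensated_le (β : Ioo (0 : ℝ) 1) (n : ℕ) (p : I × I) :
    |compensated β n p| ≤ n + 1 := by
  have h1 : ∑ k ∈ Finset.range n, displacement β (height β k p) ^ 2 ≤ n := by
    simpa using Finset.sum_le_sum fun k (_ : k ∈ Finset.range n) =>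
      sq_displacement_le β (height_mem β k p)
  have h0 : 0 ≤ ∑ k ∈ Finset.range n, displacement β (height β k p) ^ 2 :=
    Finset.sum_nonneg fun _ _ => sq_nonneg _
  have h := height_mem β n p
  rw [compensated, abs_le]
  constructor <;> nlinarith [h.1, h.2, n.cast_nonneg (α := ℝ)]

/-- The mean of `(y + d)^2` and `(y - d)^2` is `y^2 + d^2`: each step raises the second moment by
exactly the squared displacement. -/
theorem integral_compensated (β : Ioo (0 : ℝ) 1) (n : ℕ) (y : I) :
    ∫ x : I, compensated β n (x, y) = - (y : ℝ) ^ 2 := by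
  induction n generalizing y with
  | zero => simp [compensated, height_zero]
  | succ n ih =>
    have hint : ∀ z : I, Integrable fun x : I => compensated β n (x, z) := fun z =>
      .of_bound (measurable_compensated_slice β n z).aestronglyMeasurable
        (n + 1) (.of_forall fun x => abs_compensated_le β n _)
    rw [integral_eq_branches (measurable_compensated_slice β (n + 1) y)
      fun x => abs_compensated_le β (n + 1) (x, y)]
    have hr : (fun x => compensated β (n + 1) (rightBranch x, y)) =ᵐ[volume]
        fun x => displacement β y ^ 2 + compensated β n (x, fiberMap₂ β y) := by
      filter_upwards [ae_coe_pos] with x hx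
      rw [compensated_succ, planarMap_rightBranch β hx]
    rw [integral_congr_ae hr]
    simp_rw [compensated_succ, planarMap_leftBranch]
    rw [integral_add (integrable_const _) (hint _), integral_add (integrable_const _) (hint _),
      ih, ih, fiberMap₁_coe, fiberMap₂_coe]
    simp
    ring

/-- Along almost every orbit the displacements are square summable, hence tend to zero. -/
theorem ae_tendsto_displacement (β : Ioo (0 : ℝ) 1) (y : I) :
    ∀ᵐ x : I, Tendsto (fun n => displacement β (height β n (x, y))) atTop (𝓝 0) := by
  set d : ℕ → I → ℝ := fun n x => displacement β (height β n (x, y)) ^ 2 with hd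
  have hmeas : ∀ n, Measurable (d n) := fun n =>
    ((measurable_displacement β).comp (measurable_height_slice β n y)).pow_const 2
  have hd0 : ∀ n x, 0 ≤ d n x := fun n x => sq_nonneg _
  have hdint : ∀ n, Integrable (d n) := fun n =>
    .of_bound (hmeas n).aestronglyMeasurable 1 (.of_forall fun x => by
      rw [Real.norm_of_nonneg (hd0 n x)]; exact sq_displacement_le β (height_mem β _ _))
  have hsum : ∀ n, ∑ k ∈ Finset.range n, ∫ x, d k x ≤ 1 := by
    intro n
    have hsq : Integrable fun x : I => height β n (x, y) ^ 2 :=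
      .of_bound ((measurable_height_slice β n y).pow_const 2).aestronglyMeasurable 1 (.of_forall fun x => by
          have h := height_mem β n (x, y)
          rw [Real.norm_of_nonneg (sq_nonneg _)]
          nlinarith [h.1, h.2])
    -- The expected sum equals the mean of the squared height minus `y^2`, hence is at most `1` for
    -- every `n`.
    have h1 := integral_compensated β n y
    simp only [compensated] at h1
    rw [integral_sub (integrable_finsetSum _ fun k _ => hdint k) hsq,
      integral_finsetSum _ fun k _ => hdint k] at h1
    have h2 : ∫ x : I, height β n (x, y) ^ 2 ≤ ∫ _ : I, (1 : ℝ) :=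
      integral_mono hsq (integrable_const _) fun x => by
        have h := height_mem β n (x, y)
        change height β n (x, y) ^ 2 ≤ 1
        nlinarith [h.1, h.2]
    simp at h2
    simp only [hd]
    nlinarith [sq_nonneg (y : ℝ)]
  have hfin : ∫⁻ x, ∑' n, ENNReal.ofReal (d n x) ≠ ⊤ := by
    rw [lintegral_tsum fun n => (hmeas n).ennreal_ofReal.aemeasurable]
    refine ne_top_of_le_ne_top ENNReal.one_ne_top ?_
    rw [ENNReal.tsum_eq_iSup_nat]
    refine iSup_le fun n => ?_
    simp_rw [← ofReal_integral_eq_lintegral_ofReal (hdint _) (.of_forall (hd0 _))]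
    rw [← ENNReal.ofReal_sum_of_nonneg fun k _ => integral_nonneg (hd0 k)]
    exact ENNReal.ofReal_le_one.2 (hsum n)
  filter_upwards [ae_lt_top (Measurable.tsum fun n => (hmeas n).ennreal_ofReal) hfin]
    with x hx
  have hs : Tendsto (fun n => d n x) atTop (𝓝 0) := by
    have := ENNReal.summable_toReal hx.ne
    simp only [ENNReal.toReal_ofReal (hd0 _ x)] at this
    exact this.tendsto_atTop_zero
  have := hs.sqrt
  simp only [hd, Real.sqrt_sq_eq_abs, Real.sqrt_zero] at this
  exact (tendsto_zero_iff_abs_tendsto_zero _).2 this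

/-! ### Dyadic cells and self-similarity. -/

/-- The open dyadic interval `(k / 2 ^ n, (k + 1) / 2 ^ n)`. -/
def dyadicCell (n k : ℕ) : Set I := {x | (k : ℝ) < 2 ^ n * x ∧ 2 ^ n * (x : ℝ) < k + 1}

theorem isOpen_dyadicCell (n k : ℕ) : IsOpen (dyadicCell n k) := by
  have h1 : IsOpen {x : I | (k : ℝ) < 2 ^ n * x} := isOpen_lt (by fun_prop) (by fun_prop)
  have h2 : IsOpen {x : I | 2 ^ n * (x : ℝ) < k + 1} := isOpen_lt (by fun_prop) (by fun_prop)
  exact h1.inter h2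

/-- The `n`-th iterate maps the part of a horizontal line over a dyadic cell of order `n`
affinely onto a full horizontal line. -/
theorem exists_le_volume_dyadicCell (β : Ioo (0 : ℝ) 1) {n k : ℕ} (hk : k < 2 ^ n) (y : I) :
    ∃ y' : I, (∀ S : Set I, MapsTo (fiberMap₁ β) S S → MapsTo (fiberMap₂ β) S S → y ∈ S →
      y' ∈ S) ∧ ∀ B : Set (I × I), 2⁻¹ ^ n * volume {x : I | (x, y') ∈ B} ≤
        volume {x : I | x ∈ dyadicCell n k ∧ (planarMap β β)^[n] (x, y) ∈ B} := by
  -- The binary digits of `k`, leading digit first, dictate the fibre maps applied to `y`; the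
  -- result is `y'`, the same for all `x` in the cell.
  induction n generalizing k y with
  | zero =>
    obtain rfl : k = 0 := by simpa using hk
    refine ⟨y, fun S _ _ h => h, fun B => ?_⟩
    rw [pow_zero, one_mul]
    refine measure_mono_ae ?_
    have h1 : ∀ᵐ x : I, x ≠ 1 := by simp [ae_iff]
    filter_upwards [ae_coe_pos, h1] with x h0 h1 hx
    refine ⟨⟨by simpa using h0, ?_⟩, hx⟩
    have : (x : ℝ) < 1 := lt_of_le_of_ne x.2.2 fun h => h1 (Subtype.ext h)
    simpa using this
  | succ n ih =>
    rcases lt_or_ge k (2 ^ n) with hk' | hk'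
    · obtain ⟨y', hy', hB⟩ := ih hk' (fiberMap₁ β y)
      refine ⟨y', fun S h1 h2 h => hy' S h1 h2 (h1 h), fun B => ?_⟩
      rw [volume_eq_branches {x : I | x ∈ dyadicCell (n + 1) k ∧ _}, pow_succ', mul_assoc]
      refine le_add_right (mul_le_mul_right ((hB B).trans (measure_mono ?_)) _)
      rintro x ⟨⟨h1, h2⟩, hx⟩
      refine ⟨⟨?_, ?_⟩, ?_⟩
      · simp only [leftBranch, pow_succ]; linarith
      · simp only [leftBranch, pow_succ]; linarith
      · rwa [Function.iterate_succ_apply, planarMap_leftBranch]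
    · obtain ⟨j, rfl⟩ := Nat.exists_eq_add_of_le hk'
      obtain ⟨y', hy', hB⟩ := ih (k := j) (by rw [pow_succ] at hk; omega) (fiberMap₂ β y)
      refine ⟨y', fun S h1 h2 h => hy' S h1 h2 (h2 h), fun B => ?_⟩
      rw [volume_eq_branches {x : I | x ∈ dyadicCell (n + 1) _ ∧ _}, pow_succ', mul_assoc]
      refine le_add_left (mul_le_mul_right ((hB B).trans (measure_mono ?_)) _)
      rintro x ⟨⟨h1, h2⟩, hx⟩
      have hp : (0 : ℝ) < 2 ^ n := by positivity
      have h0 : 0 < (x : ℝ) := by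
        by_contra! h
        nlinarith [j.cast_nonneg (α := ℝ)]
      refine ⟨⟨?_, ?_⟩, ?_⟩
      · simp only [rightBranch, pow_succ]; push_cast; linarith
      · simp only [rightBranch, pow_succ]; push_cast; linarith
      · rwa [Function.iterate_succ_apply, planarMap_rightBranch β h0]

theorem planarMap_iterate_fst (β : Ioo (0 : ℝ) 1) (n : ℕ) (p : I × I) :
    ((planarMap β β)^[n] p).1 = baseMap^[n] p.1 := by
  induction n generalizing p with
  | zero => rfl
  | succ n ih => rw [Function.iterate_succ_apply, ih]; rfl

theorem le_volume_dyadicCell_inter {n k : ℕ} (hk : k < 2 ^ n) (A : Set I) :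
    2⁻¹ ^ n * volume A ≤ volume (dyadicCell n k ∩ baseMap^[n] ⁻¹' A) := by
  let β : Ioo (0 : ℝ) 1 := ⟨1 / 2, by norm_num, by norm_num⟩
  obtain ⟨y', -, h⟩ := exists_le_volume_dyadicCell β hk 0
  have := h {p | p.1 ∈ A}
  simp only [mem_ofPred_eq, planarMap_iterate_fst] at this
  exact this

theorem volume_dyadicCell_pos {n k : ℕ} (hk : k < 2 ^ n) : 0 < volume (dyadicCell n k) := by
  have h := le_volume_dyadicCell_inter hk univ
  rw [preimage_univ, inter_univ, measure_univ, mul_one] at h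
  exact lt_of_lt_of_le (ENNReal.pow_pos (by norm_num) n) h

/-- Dyadic cells form a `π`-base of the topology of `I`. -/
theorem exists_dyadicCell_subset {J : Set I} (hJ : IsOpen J) (hne : J.Nonempty) :
    ∃ n k, k < 2 ^ n ∧ dyadicCell n k ⊆ J := by
  obtain ⟨x₀, hx₀⟩ := hne
  obtain ⟨ε, hε, hball⟩ := Metric.isOpen_iff.1 hJ x₀ hx₀
  obtain ⟨n, hn⟩ := exists_pow_lt_of_lt_one hε (by norm_num : (1 / 2 : ℝ) < 1)
  have hp : (0 : ℝ) < 2 ^ n := by positivity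
  have hn' : 1 < 2 ^ n * ε := by
    rw [div_pow, one_pow, div_lt_iff₀ hp] at hn
    linarith
  have h0 := x₀.2.1
  have h1 := x₀.2.2
  obtain ⟨k, hk, hk1, hk2⟩ : ∃ k : ℕ, k < 2 ^ n ∧ (k : ℝ) ≤ 2 ^ n * x₀ ∧
      2 ^ n * (x₀ : ℝ) ≤ k + 1 := by
    -- At `x₀ = 1` the floor would be `2 ^ n`, so the last cell is used instead.
    rcases eq_or_lt_of_le h1 with h | h
    · refine ⟨2 ^ n - 1, Nat.sub_lt (by positivity) one_pos, ?_, ?_⟩ <;>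
        rw [h, Nat.cast_sub Nat.one_le_two_pow] <;> push_cast <;> linarith
    · have hf := Nat.floor_le (mul_nonneg hp.le h0)
      refine ⟨⌊2 ^ n * (x₀ : ℝ)⌋₊, ?_, hf, (Nat.lt_floor_add_one _).le⟩
      have : ((⌊2 ^ n * (x₀ : ℝ)⌋₊ : ℕ) : ℝ) < (2 ^ n : ℕ) := by push_cast; nlinarith
      exact_mod_cast this
  refine ⟨n, k, hk, fun x hx => hball ?_⟩
  rw [Metric.mem_ball, Subtype.dist_eq, Real.dist_eq, abs_lt]
  obtain ⟨hx1, hx2⟩ := hx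
  constructor <;> nlinarith

theorem volume_pos_of_isOpen {J : Set I} (hJ : IsOpen J) (hne : J.Nonempty) : 0 < volume J := by
  obtain ⟨n, k, hk, h⟩ := exists_dyadicCell_subset hJ hne
  exact (volume_dyadicCell_pos hk).trans_le (measure_mono h)

/-! ### Recurrence of the doubling map and minimality. -/

/-- Almost every orbit of the doubling map visits a given dyadic cell. -/
theorem ae_exists_iterate_mem {n k : ℕ} (hk : k < 2 ^ n) :
    ∀ᵐ x : I, ∃ m, baseMap^[m] x ∈ dyadicCell n k := by
  set N : Set I := {x | ¬ ∃ m, baseMap^[m] x ∈ dyadicCell n k} with hN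
  change volume N = 0
  have hNm : MeasurableSet N := by
    have : N = ⋂ m, (baseMap^[m] ⁻¹' dyadicCell n k)ᶜ := by ext; simp [hN]
    rw [this]
    exact .iInter fun m =>
      (measurable_baseMap.iterate m (isOpen_dyadicCell n k).measurableSet).compl
  -- The preimage of `N` has the measure of `N`, so its part in the cell is null; by self-similarity
  -- that part has measure at least `2⁻¹ ^ n * volume N`.
  have hsub : N ⊆ baseMap^[n] ⁻¹' N \ dyadicCell n k := by
    refine fun x hx => ⟨fun ⟨m, hm⟩ => hx ⟨m + n, ?_⟩, fun h => hx ⟨0, h⟩⟩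
    rwa [Function.iterate_add_apply]
  have h1 := le_volume_dyadicCell_inter hk N
  have h2 : volume (dyadicCell n k ∩ baseMap^[n] ⁻¹' N) + volume N ≤ volume N := by
    calc _ ≤ volume (baseMap^[n] ⁻¹' N ∩ dyadicCell n k) +
          volume (baseMap^[n] ⁻¹' N \ dyadicCell n k) := by
            rw [inter_comm]; gcongr
      _ = volume (baseMap^[n] ⁻¹' N) :=
          measure_inter_add_sdiff _ (isOpen_dyadicCell n k).measurableSet
      _ = volume N := (measurePreserving_baseMap.iterate n).measure_preimage hNm.nullMeasurableSet
  have h3 : volume (dyadicCell n k ∩ baseMap^[n] ⁻¹' N) = 0 := by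
    by_contra h
    exact (ENNReal.lt_add_right (measure_ne_top volume N) h).not_ge (by rwa [add_comm] at h2)
  rw [h3, nonpos_iff_eq_zero, mul_eq_zero] at h1
  exact h1.resolve_left (ENNReal.pow_pos (by norm_num) n).ne'

/-- Almost every orbit of the doubling map accumulates everywhere. -/
theorem ae_forall_mapClusterPt :
    ∀ᵐ x : I, ∀ t : I, MapClusterPt t atTop fun n => baseMap^[n] x := by
  have h : ∀ᵐ x : I, ∀ n k j : ℕ, k < 2 ^ n → ∃ m, baseMap^[m] (baseMap^[j] x) ∈
      dyadicCell n k := by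
    simp only [ae_all_iff]
    intro n k j hk
    exact (measurePreserving_baseMap.quasiMeasurePreserving.iterate j).ae (ae_exists_iterate_mem hk)
  filter_upwards [h] with x hx t
  rw [mapClusterPt_iff_frequently]
  intro s hs
  obtain ⟨n, k, hk, hsub⟩ := exists_dyadicCell_subset isOpen_interior
    ⟨t, mem_interior_iff_mem_nhds.2 hs⟩
  refine frequently_atTop.2 fun j => ?_
  obtain ⟨m, hm⟩ := hx n k j hk
  refine ⟨m + j, Nat.le_add_left _ _, interior_subset (hsub ?_)⟩
  rwa [Function.iterate_add_apply]

/-- A compact proper subset of a horizontal line has a null basin. -/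
theorem volume_basin_eq_zero (β : Ioo (0 : ℝ) 1) {c : I} {A : Set (I × I)} (hA : A ⊂ hLine c) :
    volume (basin (planarMap β β) A) = 0 := by
  have hfst : ∀ᵐ p : I × I, ∀ t : I, MapClusterPt t atTop fun n => baseMap^[n] p.1 :=
    Measure.quasiMeasurePreserving_fst.ae ae_forall_mapClusterPt
  refine measure_mono_null (fun p hp => ?_) (ae_iff.1 hfst)
  intro ht
  obtain ⟨q, hq, hqA⟩ := exists_of_ssubset hA
  -- Along one ultrafilter the base converges to `q.1` and, by compactness, the height converges
  -- too; the basin condition then forces that height to be `c`.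
  obtain ⟨U, hU, hUt⟩ := mapClusterPt_iff_ultrafilter.1 (ht q.1)
  obtain ⟨y, -, hy⟩ := isCompact_univ.ultrafilter_le_nhds
    (U.map fun n => ((planarMap β β)^[n] p).2) (by simp)
  have hmem : (q.1, y) ∈ omegaLimit atTop (fun n : ℕ => (planarMap β β)^[n]) {p} := by
    rw [mem_omegaLimit_singleton_iff_mapClusterPt, mapClusterPt_iff_ultrafilter]
    refine ⟨U, hU, ?_⟩
    have hy' : Tendsto (fun n => ((planarMap β β)^[n] p).2) U (𝓝 y) := hy
    simpa only [← planarMap_iterate_fst β] using hUt.prodMk_nhds hy'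
  have hyc : y = c := hA.1 (hp hmem)
  have hqc : q.2 = c := hq
  refine hqA (hp ?_)
  rwa [hyc, ← hqc] at hmem

/-! ### Convergence to the edges of an invariant strip. -/

/-- `Icc a b` is an invariant strip on which the displacement vanishes only at the ends. -/
structure IsStrip (β : Ioo (0 : ℝ) 1) (a b : I) : Prop where
  lt : (a : ℝ) < b
  mapsTo₁ : MapsTo (fiberMap₁ β) (Icc a b) (Icc a b)
  mapsTo₂ : MapsTo (fiberMap₂ β) (Icc a b) (Icc a b)
  mapsTo₁' : MapsTo (fiberMap₁ β) (Ioo a b) (Ioo a b)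
  mapsTo₂' : MapsTo (fiberMap₂ β) (Ioo a b) (Ioo a b)
  bound : ∃ c : ℝ, 0 < c ∧ ∀ y : I, y ∈ Icc a b →
    c * ((y - a) * (b - y)) ≤ |displacement β y|

theorem mapsTo_planarMap {β : Ioo (0 : ℝ) 1} {S : Set I} (h₁ : MapsTo (fiberMap₁ β) S S)
    (h₂ : MapsTo (fiberMap₂ β) S S) :
    MapsTo (planarMap β β) {p | p.2 ∈ S} {p | p.2 ∈ S} := by
  intro p hp
  change (if (p.1 : ℝ) ≤ 1 / 2 then fiberMap₁ β p.2 else fiberMap₂ β p.2) ∈ S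
  split_ifs
  exacts [h₁ hp, h₂ hp]

theorem abs_height_succ_sub (β : Ioo (0 : ℝ) 1) (n : ℕ) (p : I × I) :
    |height β (n + 1) p - height β n p| = |displacement β (height β n p)| := by
  simp only [height, Function.iterate_succ_apply']
  generalize (planarMap β β)^[n] p = q
  by_cases h : (q.1 : ℝ) ≤ 1 / 2
  · simp only [planarMap, if_pos h, fiberMap₁_coe]
    congr 1
    ring
  · simp only [planarMap, if_neg h, fiberMap₂_coe]
    rw [← abs_neg]
    congr 1
    ring

/-- A sequence in `[a, b]` with small steps that approaches `{a, b}` converges to `a` or `b`. -/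
theorem tendsto_or_tendsto_of_steps {a b : ℝ} (hab : a < b) {u : ℕ → ℝ}
    (hu : ∀ n, u n ∈ Icc a b) (hstep : Tendsto (fun n => u (n + 1) - u n) atTop (𝓝 0))
    (hprod : Tendsto (fun n => (u n - a) * (b - u n)) atTop (𝓝 0)) :
    Tendsto u atTop (𝓝 a) ∨ Tendsto u atTop (𝓝 b) := by
  have hd : 0 < b - a := sub_pos.2 hab
  -- At distance at least `(b - a) / 4` from both ends the product is at least `3 * (b - a) ^ 2 /
  -- 16`. So late terms lie closer than that to an end, and changing sides would take a step longer
  -- than `(b - a) / 2`.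
  obtain ⟨N, hN⟩ := eventually_atTop.1
    ((hstep.abs.eventually_lt_const (u := (b - a) / 4) (by simpa using by linarith)).and
      (hprod.eventually_lt_const (u := (b - a) ^ 2 / 16) (by positivity)))
  have hside : ∀ n ≥ N, (u n < (a + b) / 2 ↔ u (n + 1) < (a + b) / 2) := by
    intro n hn
    obtain ⟨h1, h2⟩ := hN n hn
    obtain ⟨-, h2'⟩ := hN (n + 1) (by omega)
    obtain ⟨h3, h4⟩ := abs_lt.1 h1
    have ha := hu n
    have ha' := hu (n + 1)
    constructor
    · intro h
      by_contra! h'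
      nlinarith [ha.1, ha.2, ha'.1, ha'.2]
    · intro h
      by_contra! h'
      nlinarith [ha.1, ha.2, ha'.1, ha'.2]
  have hall : ∀ n ≥ N, (u n < (a + b) / 2 ↔ u N < (a + b) / 2) := by
    intro n hn
    induction n, hn using Nat.le_induction with
    | base => rfl
    | succ n hn ih => rw [← hside n hn, ih]
  -- On a fixed side of the midpoint the far factor is at least `(b - a) / 2`, so this dominates the
  -- distance to the near end.
  have hlim : Tendsto (fun n => 2 / (b - a) * ((u n - a) * (b - u n))) atTop (𝓝 0) := by
    simpa using hprod.const_mul (2 / (b - a))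
  by_cases h : u N < (a + b) / 2
  · left
    rw [← tendsto_sub_nhds_zero_iff]
    refine squeeze_zero' (.of_forall fun n => sub_nonneg.2 (hu n).1) ?_ hlim
    filter_upwards [eventually_ge_atTop N] with n hn
    have := (hall n hn).2 h
    rw [div_mul_eq_mul_div, le_div_iff₀ hd]
    nlinarith [(hu n).1, (hu n).2]
  · right
    suffices h0 : Tendsto (fun n => b - u n) atTop (𝓝 0) by simpa using h0.const_sub b
    refine squeeze_zero' (.of_forall fun n => sub_nonneg.2 (hu n).2) ?_ hlim
    filter_upwards [eventually_ge_atTop N] with n hn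
    have := not_lt.1 (mt (hall n hn).1 h)
    rw [div_mul_eq_mul_div, le_div_iff₀ hd]
    nlinarith [(hu n).1, (hu n).2]

theorem IsStrip.ae_tendsto {β : Ioo (0 : ℝ) 1} {a b : I} (h : IsStrip β a b) {y : I}
    (hy : y ∈ Icc a b) :
    ∀ᵐ x : I, Tendsto (fun n => height β n (x, y)) atTop (𝓝 a) ∨
      Tendsto (fun n => height β n (x, y)) atTop (𝓝 b) := by
  filter_upwards [ae_tendsto_displacement β y] with x hx
  obtain ⟨c, hc, hbound⟩ := h.bound
  have hmem : ∀ n, ((planarMap β β)^[n] (x, y)).2 ∈ Icc a b :=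
    fun n => (mapsTo_planarMap h.mapsTo₁ h.mapsTo₂).iterate n hy
  have habs := hx.abs
  rw [abs_zero] at habs
  refine tendsto_or_tendsto_of_steps h.lt hmem ?_ ?_
  · refine (tendsto_zero_iff_abs_tendsto_zero _).2 ?_
    simpa only [Function.comp_def, abs_height_succ_sub] using habs
  · have hle : ∀ n, c * ((height β n (x, y) - a) * (b - height β n (x, y))) ≤
        |displacement β (height β n (x, y))| := fun n => hbound _ (hmem n)
    have h0 : ∀ n, 0 ≤ (height β n (x, y) - a) * (b - height β n (x, y)) := fun n =>
      mul_nonneg (sub_nonneg.2 (hmem n).1) (sub_nonneg.2 (hmem n).2)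
    refine squeeze_zero h0 (fun n => ?_) (by simpa using habs.const_mul c⁻¹)
    rw [← div_eq_inv_mul, le_div_iff₀ hc, mul_comm]
    exact hle n

/-- By conservation of the mean, not almost every orbit over `y ≠ c` converges to height `c`. -/
theorem not_ae_tendsto_height (β : Ioo (0 : ℝ) 1) {y c : I} (hyc : y ≠ c) :
    ¬ ∀ᵐ x : I, Tendsto (fun n => height β n (x, y)) atTop (𝓝 c) := by
  intro h
  have hlim := tendsto_integral_of_dominated_convergence (fun _ => 1)
    (fun n => (measurable_height_slice β n y).aestronglyMeasurable) (integrable_const (1 : ℝ))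
    (fun n => .of_forall fun x => by
      rw [Real.norm_of_nonneg (height_mem β n _).1]; exact (height_mem β n _).2) h
  simp_rw [integral_height] at hlim
  refine hyc (Subtype.ext ?_)
  simpa using tendsto_nhds_unique tendsto_const_nhds hlim

theorem IsStrip.volume_tendsto_pos {β : Ioo (0 : ℝ) 1} {a b : I} (h : IsStrip β a b) {y : I}
    (hy : y ∈ Ioo a b) {c : I} (hc : c = a ∨ c = b) :
    0 < volume {x : I | Tendsto (fun n => height β n (x, y)) atTop (𝓝 c)} := by
  rw [pos_iff_ne_zero]
  intro h0
  have hae : ∀ᵐ x : I, ¬ Tendsto (fun n => height β n (x, y)) atTop (𝓝 c) := by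
    rw [ae_iff]
    simpa using h0
  rcases hc with rfl | rfl
  · refine not_ae_tendsto_height β hy.2.ne ?_
    filter_upwards [hae, h.ae_tendsto (Ioo_subset_Icc_self hy)] with x h1 h2
    exact h2.resolve_left h1
  · refine not_ae_tendsto_height β hy.1.ne' ?_
    filter_upwards [hae, h.ae_tendsto (Ioo_subset_Icc_self hy)] with x h1 h2
    exact h2.resolve_right h1

theorem tendsto_height_iterate (β : Ioo (0 : ℝ) 1) (n : ℕ) (p : I × I) (c : ℝ) :
    Tendsto (fun m => height β m ((planarMap β β)^[n] p)) atTop (𝓝 c) ↔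
      Tendsto (fun m => height β m p) atTop (𝓝 c) := by
  rw [← tendsto_add_atTop_iff_nat (f := fun m => height β m p) n]
  simp only [height, Function.iterate_add_apply]

theorem mem_basin_hLine {β : Ioo (0 : ℝ) 1} {p : I × I} {c : I}
    (h : Tendsto (fun n => height β n p) atTop (𝓝 c)) :
    p ∈ basin (planarMap β β) (hLine c) := by
  intro q hq
  rw [mem_omegaLimit_singleton_iff_mapClusterPt, mapClusterPt_iff_ultrafilter] at hq
  obtain ⟨U, hU, hq⟩ := hq
  have h1 : Tendsto (fun n => height β n p) U (𝓝 (q.2 : ℝ)) :=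
    ((continuous_subtype_val.comp continuous_snd).tendsto q).comp hq
  exact Subtype.ext (tendsto_nhds_unique h1 (h.mono_left hU))

theorem IsStrip.volume_basin_pos {β : Ioo (0 : ℝ) 1} {a b : I} (h : IsStrip β a b) {c : I}
    (hc : c = a ∨ c = b) {U : Set (I × I)} (hU : IsOpen U)
    (hne : (U ∩ {p | p.2 ∈ Icc a b}).Nonempty) :
    0 < volume (U ∩ {p | p.2 ∈ Icc a b} ∩ basin (planarMap β β) (hLine c)) := by
  obtain ⟨⟨x₀, y₀⟩, hp, hy₀⟩ := hne
  obtain ⟨J, K, hJ, hK, hxJ, hyK, hJK⟩ := isOpen_prod_iff.1 hU x₀ y₀ hp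
  obtain ⟨n, k, hk, hD⟩ := exists_dyadicCell_subset hJ ⟨x₀, hxJ⟩
  have hab : a < b := h.lt
  have hK' : 0 < volume (K ∩ Ioo a b) := by
    refine volume_pos_of_isOpen (hK.inter isOpen_Ioo) ?_
    -- The height `y₀` may lie on an edge; interior heights are still arbitrarily close.
    refine mem_closure_iff.1 ?_ K hK hyK
    rw [closure_Ioo hab.ne]
    exact hy₀
  -- A measurable subset of the basin, so that Fubini applies.
  set T : Set (I × I) := {p | Tendsto (fun n => height β n p) atTop (𝓝 (c : ℝ))} with hT
  have hTm : MeasurableSet T := measurableSet_tendsto _ (measurable_height β)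
  set W : Set (I × I) := dyadicCell n k ×ˢ (K ∩ Ioo a b) ∩ T with hW
  have hWm : MeasurableSet W :=
    ((isOpen_dyadicCell n k).measurableSet.prod
      (hK.measurableSet.inter measurableSet_Ioo)).inter hTm
  have hslice : ∀ y ∈ K ∩ Ioo a b, 0 < volume ((fun x => (x, y)) ⁻¹' W) := by
    intro y hy
    obtain ⟨y', hy', hB⟩ := exists_le_volume_dyadicCell β hk y
    have hpos := h.volume_tendsto_pos (hy' _ h.mapsTo₁' h.mapsTo₂' hy.2) hc
    refine lt_of_lt_of_le (ENNReal.mul_pos (ENNReal.pow_pos (by norm_num) n).ne' hpos.ne')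
      ((hB T).trans (measure_mono ?_))
    rintro x ⟨hx, hxT⟩
    exact ⟨⟨hx, hy⟩, (tendsto_height_iterate β n _ _).1 hxT⟩
  have hWpos : 0 < volume W := by
    rw [pos_iff_ne_zero]
    intro h0
    rw [Measure.volume_eq_prod, Measure.prod_apply_symm hWm,
      lintegral_eq_zero_iff (measurable_measure_prodMk_right hWm)] at h0
    refine hK'.ne' (measure_mono_null (fun y hy => ?_) (ae_iff.1 h0))
    exact (hslice y hy).ne'
  refine hWpos.trans_le (measure_mono ?_)
  rintro ⟨x, y⟩ ⟨⟨hx, hy⟩, hxT⟩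
  exact ⟨⟨hJK ⟨hD hx, hy.1⟩, Ioo_subset_Icc_self hy.2⟩, mem_basin_hLine hxT⟩

/-! ### The two strips between the fixed heights. -/

theorem isStrip_lower (β : Ioo (0 : ℝ) 1) : IsStrip β 0 (toHeight β) := by
  have b0 := β.2.1
  have b1 := β.2.2
  -- On this strip `1 - y ≥ 1 - β`.
  refine ⟨b0, ?_, ?_, ?_, ?_, 1 - β, by linarith, ?_⟩
  · rintro y ⟨-, hy⟩
    have h0 : 0 ≤ (y : ℝ) := y.2.1
    have hy : (y : ℝ) ≤ β := hy
    refine ⟨(fiberMap₁ β y).2.1, ?_⟩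
    change (y : ℝ) + y * (1 - y) * (y - β) ≤ β
    nlinarith [mul_nonneg h0 (sub_nonneg.2 y.2.2)]
  · rintro y ⟨-, hy⟩
    have h0 : 0 ≤ (y : ℝ) := y.2.1
    have hy : (y : ℝ) ≤ β := hy
    refine ⟨(fiberMap₂ β y).2.1, ?_⟩
    change (y : ℝ) - y * (1 - y) * (y - β) ≤ β
    -- The gap `β - g₂(y)` factors as `(β - y) * (1 - y * (1 - y))`; the other invariance bounds use
    -- similar factorings.
    have : 0 ≤ 1 - (y : ℝ) * (1 - y) := by nlinarith
    nlinarith [mul_nonneg (sub_nonneg.2 hy) this]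
  · rintro y ⟨h0, hy⟩
    have h0 : 0 < (y : ℝ) := h0
    have hy : (y : ℝ) < β := hy
    constructor
    · change 0 < (y : ℝ) + y * (1 - y) * (y - β)
      have : 0 < 1 - (1 - (y : ℝ)) * (β - y) := by nlinarith
      nlinarith [mul_pos h0 this]
    · change (y : ℝ) + y * (1 - y) * (y - β) < β
      nlinarith [mul_nonneg h0.le (sub_nonneg.2 y.2.2)]
  · rintro y ⟨h0, hy⟩
    have h0 : 0 < (y : ℝ) := h0
    have hy : (y : ℝ) < β := hy
    have h1 : (y : ℝ) < 1 := hy.trans b1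
    constructor
    · change 0 < (y : ℝ) - y * (1 - y) * (y - β)
      nlinarith [mul_nonneg h0.le (sub_nonneg.2 y.2.2)]
    · change (y : ℝ) - y * (1 - y) * (y - β) < β
      have : 0 < 1 - (y : ℝ) * (1 - y) := by nlinarith
      nlinarith [mul_pos (sub_pos.2 hy) this]
  · rintro y ⟨-, hy⟩
    have h0 : 0 ≤ (y : ℝ) := y.2.1
    have hy : (y : ℝ) ≤ β := hy
    change (1 - (β : ℝ)) * (((y : ℝ) - 0) * (β - y)) ≤ |(y : ℝ) * (1 - y) * (y - β)|
    refine le_trans ?_ (neg_le_abs _)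
    nlinarith [mul_nonneg (mul_nonneg h0 (sub_nonneg.2 hy)) (sub_nonneg.2 hy)]

theorem isStrip_upper (β : Ioo (0 : ℝ) 1) : IsStrip β (toHeight β) 1 := by
  have b0 := β.2.1
  have b1 := β.2.2
  refine ⟨b1, ?_, ?_, ?_, ?_, β, b0, ?_⟩
  · rintro y ⟨hy, -⟩
    have h1 : (y : ℝ) ≤ 1 := y.2.2
    have hy : (β : ℝ) ≤ y := hy
    refine ⟨?_, (fiberMap₁ β y).2.2⟩
    change (β : ℝ) ≤ (y : ℝ) + y * (1 - y) * (y - β)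
    nlinarith [mul_nonneg y.2.1 (sub_nonneg.2 h1)]
  · rintro y ⟨hy, -⟩
    have h1 : (y : ℝ) ≤ 1 := y.2.2
    have hy : (β : ℝ) ≤ y := hy
    refine ⟨?_, (fiberMap₂ β y).2.2⟩
    change (β : ℝ) ≤ (y : ℝ) - y * (1 - y) * (y - β)
    have : 0 ≤ 1 - (y : ℝ) * (1 - y) := by nlinarith
    nlinarith [mul_nonneg (sub_nonneg.2 hy) this]
  · rintro y ⟨hy, h1⟩
    have h1 : (y : ℝ) < 1 := h1
    have hy : (β : ℝ) < y := hy
    constructor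
    · change (β : ℝ) < (y : ℝ) + y * (1 - y) * (y - β)
      nlinarith [mul_nonneg y.2.1 (sub_nonneg.2 h1.le)]
    · change (y : ℝ) + y * (1 - y) * (y - β) < 1
      have : 0 < 1 - (y : ℝ) * (y - β) := by nlinarith
      nlinarith [mul_pos (sub_pos.2 h1) this]
  · rintro y ⟨hy, h1⟩
    have h1 : (y : ℝ) < 1 := h1
    have hy : (β : ℝ) < y := hy
    constructor
    · change (β : ℝ) < (y : ℝ) - y * (1 - y) * (y - β)
      have : 0 < 1 - (y : ℝ) * (1 - y) := by nlinarith
      nlinarith [mul_pos (sub_pos.2 hy) this]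
    · change (y : ℝ) - y * (1 - y) * (y - β) < 1
      nlinarith [mul_nonneg y.2.1 (sub_nonneg.2 h1.le)]
  · rintro y ⟨hy, -⟩
    have h1 : (y : ℝ) ≤ 1 := y.2.2
    have hy : (β : ℝ) ≤ y := hy
    change (β : ℝ) * (((y : ℝ) - β) * (1 - y)) ≤ |(y : ℝ) * (1 - y) * (y - β)|
    refine le_trans ?_ (le_abs_self _)
    nlinarith [mul_nonneg (mul_nonneg (sub_nonneg.2 h1) (sub_nonneg.2 hy)) (sub_nonneg.2 hy)]

/-! ### Milnor attractors and intermingling. -/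

theorem image_hLine {β : Ioo (0 : ℝ) 1} {c : I} (h₁ : fiberMap₁ β c = c)
    (h₂ : fiberMap₂ β c = c) : planarMap β β '' hLine c = hLine c := by
  refine Subset.antisymm ?_ fun p hp => ?_
  · rintro _ ⟨p, hp, rfl⟩
    obtain rfl : p.2 = c := hp
    change (if (p.1 : ℝ) ≤ 1 / 2 then fiberMap₁ β p.2 else fiberMap₂ β p.2) = p.2
    rw [h₁, h₂, ite_self]
  · have hp : p.2 = c := hp
    refine ⟨(leftBranch p.1, c), rfl, ?_⟩
    rw [planarMap_leftBranch, h₁, ← hp]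

theorem isMilnorAttractor_hLine {β : Ioo (0 : ℝ) 1} {c : I} (hc : displacement β c = 0)
    (hpos : 0 < volume (basin (planarMap β β) (hLine c))) :
    IsMilnorAttractor (planarMap β β) (hLine c) where
  isCompact := (isClosed_eq continuous_snd continuous_const).isCompact
  image_eq := image_hLine (Subtype.ext (by rw [fiberMap₁_coe, hc, add_zero]))
    (Subtype.ext (by rw [fiberMap₂_coe, hc, sub_zero]))
  basin_pos := hpos
  minimal A' hA' _ heq := by
    rw [← measure_congr heq, volume_basin_eq_zero β hA'] at hpos
    exact hpos.false

theorem hLine_injective : Function.Injective hLine := fun c d h => by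
  have : ((0 : I), c) ∈ hLine d := h ▸ (rfl : ((0 : I), c) ∈ hLine c)
  exact this

theorem IsStrip.intermingledWithin {β : Ioo (0 : ℝ) 1} {a b : I} (h : IsStrip β a b) :
    IntermingledWithin (planarMap β β) {p | p.2 ∈ Icc a b} (hLine a) (hLine b) :=
  ⟨mapsTo_planarMap h.mapsTo₁ h.mapsTo₂, fun _ hU hne =>
    ⟨h.volume_basin_pos (.inl rfl) hU hne, h.volume_basin_pos (.inr rfl) hU hne⟩⟩

theorem IntermingledWithin.symm {M : Type*} [TopologicalSpace M] [MeasureSpace M] {F : M → M}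
    {S A A' : Set M} (h : IntermingledWithin F S A A') : IntermingledWithin F S A' A :=
  ⟨h.1, fun U hU hne => (h.2 U hU hne).symm⟩

theorem IntermingledWithin.intermingled {M : Type*} [PseudoMetricSpace M] [MeasureSpace M]
    {F : M → M} {S A A' : Set M} (h : IntermingledWithin F S A A') (hA : IsMilnorAttractor F A)
    (hA' : IsMilnorAttractor F A') (hne : A ≠ A') (hAS : A ⊆ S) (hAS' : A' ⊆ S) :
    Intermingled F A A' := by
  refine ⟨⟨hA, hA', hne, fun p hp ε hε => ?_⟩, ⟨hA', hA, hne.symm, fun p hp ε hε => ?_⟩⟩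
  · refine (h.2 _ Metric.isOpen_ball ⟨p, Metric.mem_ball_self hε, hAS hp⟩).2.trans_le ?_
    exact measure_mono (inter_subset_inter_left _ inter_subset_left)
  · refine (h.2 _ Metric.isOpen_ball ⟨p, Metric.mem_ball_self hε, hAS' hp⟩).1.trans_le ?_
    exact measure_mono (inter_subset_inter_left _ inter_subset_left)

theorem mainTheorem10 (β : Ioo (0 : ℝ) 1) (hβ : ((β : ℝ), (β : ℝ)) ∈ GammaS) :
    IsMilnorAttractor (planarMap β β) (hLine 0) ∧
    IsMilnorAttractor (planarMap β β) (hLine 1) ∧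
    IsMilnorAttractor (planarMap β β) (hLine (toHeight β)) ∧
    hLine 0 ≠ hLine 1 ∧
    Intermingled (planarMap β β) (hLine 0) (hLine (toHeight β)) ∧
    Intermingled (planarMap β β) (hLine 1) (hLine (toHeight β)) ∧
    IntermingledWithin (planarMap β β) {p | p.2 ≤ toHeight β} (hLine 0) (hLine (toHeight β)) ∧
    IntermingledWithin (planarMap β β) {p | toHeight β ≤ p.2} (hLine 1) (hLine (toHeight β)) := by
  have hlow := (isStrip_lower β).intermingledWithin
  have hupp := (isStrip_upper β).intermingledWithin.symm
  have e0 : {p : I × I | p.2 ∈ Icc 0 (toHeight β)} = {p | p.2 ≤ toHeight β} := by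
    ext p; exact ⟨fun h => h.2, fun h => ⟨p.2.2.1, h⟩⟩
  have e1 : {p : I × I | p.2 ∈ Icc (toHeight β) 1} = {p | toHeight β ≤ p.2} := by
    ext p; exact ⟨fun h => h.1, fun h => ⟨h, p.2.2.2⟩⟩
  rw [e0] at hlow
  rw [e1] at hupp
  have l0 := hlow.2 univ isOpen_univ ⟨(0, 0), trivial, (toHeight β).2.1⟩
  have l1 := hupp.2 univ isOpen_univ ⟨(0, 1), trivial, (toHeight β).2.2⟩
  have h0 : IsMilnorAttractor (planarMap β β) (hLine 0) :=
    isMilnorAttractor_hLine (by simp [displacement])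
      (l0.1.trans_le (measure_mono inter_subset_right))
  have h1 : IsMilnorAttractor (planarMap β β) (hLine 1) :=
    isMilnorAttractor_hLine (by simp [displacement])
      (l1.1.trans_le (measure_mono inter_subset_right))
  have hb : IsMilnorAttractor (planarMap β β) (hLine (toHeight β)) :=
    isMilnorAttractor_hLine (by simp [displacement, toHeight])
      (l0.2.trans_le (measure_mono inter_subset_right))
  have n0 : (0 : I) ≠ toHeight β := fun h => β.2.1.ne (congrArg Subtype.val h)
  have n1 : (1 : I) ≠ toHeight β := fun h => β.2.2.ne' (congrArg Subtype.val h)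
  refine ⟨h0, h1, hb, hLine_injective.ne zero_ne_one, ?_, ?_, hlow, hupp⟩
  · refine hlow.intermingled h0 hb (hLine_injective.ne n0) ?_ ?_
    · rintro p hp
      exact (show p.2 = 0 from hp).trans_le (toHeight β).2.1
    · rintro p hp
      exact (show p.2 = toHeight β from hp).le
  · refine hupp.intermingled h1 hb (hLine_injective.ne n1) ?_ ?_
    · rintro p hp
      exact (toHeight β).2.2.trans (show p.2 = 1 from hp).ge
    · rintro p hp
      exact (show p.2 = toHeight β from hp).ge
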